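/- **Theorem (structure theorem).** Let $K$ be a field. Let $\mathbf{ch}$ be the category of compact non-negatively graded chain complexes of $K$-vector spaces, i.e. complexes $X$ with $\bigoplus_n X_n$ finite dimensional; a morphism of $\mathbf{ch}$ is a cofibration if it is a monomorphism in every degree. A functor $X\colon[0,\infty)\to\mathbf{ch}$ is *tame* if there is a finite sequence $\tau_0<\dots<\tau_k$ in $[0,\infty)$ that discretises it, i.e. such that the transition $X^{s\le t}\colon X^s\to X^t$ is an isomorphism unless $s<\tau_a\le t$ for some $a$. Let $\mathrm{tame}([0,\infty),\mathbf{ch})$ be the category of tame functors and natural transformations. A morphism $g\colon X\to Y$ in it is a *cofibration* if, for some (equivalently, any) sequence $0=\tau_0<\dots<\tau_k$ discretising both $X$ and $Y$, the morphism $g^0\colon X^0\to Y^0$ and the induced morphisms $Y^{\tau_{a-1}}\sqcup_{X^{\tau_{a-1}}}X^{\tau_a}\to Y^{\tau_a}$, $a=1,\dots,k$, are cofibrations in $\mathbf{ch}$. An object $X$ is *cofibrant* if the morphism from the initial object to $X$ is a cofibration (equivalently, all transitions $X^{s\le t}$ are monomorphisms). Let $S^n$ be the complex with $K$ in degree $n$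 and zero elsewhere, and let $D^{n+1}$ be the complex with $K$ in degrees $n+1$ and $n$, with differential the identity between them, and zero elsewhere. For $n\in\mathbb N$, $s\in[0,\infty)$ and $e\in[0,\infty]$ with $s\le e$, the *interval sphere* $S^n[s,e)$ is the tame functor whose value at $t$ is $0$ if $t<s$, $S^n$ if $s\le t<e$, and $D^{n+1}$ if $e\le t$, with transitions the identities and the inclusions $0\hookrightarrow S^n\hookrightarrow D^{n+1}$. 1. Every cofibrant object of $\mathrm{tame}([0,\infty),\mathbf{ch})$ is isomorphic to a finite direct sum $\bigoplus_{i=1}^{l}S^{n_i}[s_i,e_i)$, where $l$ may be $0$. 2. If $\bigoplus_{i=1}^{l}S^{n_i}[s_i,e_i)\cong\bigoplus_{j=1}^{l'}S^{n'_j}[s'_j,e'_j)$, then $l=l'$ and there is a permutation $\sigma$ of $\{1,\dots,l\}$ with $n_i=n'_{\sigma(i)}$, $s_i=s'_{\sigma(i)}$ and $e_i=e'_{\sigma(i)}$ for every $i$. -/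

import Mathlib

open CategoryTheory CategoryTheory.Limits HomotopicalAlgebra
open scoped NNReal ENNReal DirectSum

universe v u

/-! ### Tame functors `[0,∞) ⥤ M` -/

section Tame

variable {M : Type u} [Category.{v} M]

/-- The sequence `τ 0, …, τ k` discretises `X`: the transition `X^s ⟶ X^t` may fail to be an
isomorphism only if `s < τ a ≤ t` for some `a`. -/
def Discretises {k : ℕ} (τ : Fin (k + 1) → ℝ≥0) (X : ℝ≥0 ⥤ M) : Prop :=
  ∀ ⦃s t : ℝ≥0⦄ (h : s ≤ t), (¬ ∃ a, s < τ a ∧ τ a ≤ t) → IsIso (X.map (homOfLE h))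

/-- A functor on `[0,∞)` is tame if some strictly increasing finite sequence discretises it. -/
def IsTame (M : Type u) [Category.{v} M] : ObjectProperty (ℝ≥0 ⥤ M) := fun X ↦
  ∃ (k : ℕ) (τ : Fin (k + 1) → ℝ≥0), StrictMono τ ∧ Discretises τ X

/-- The category of tame `[0,∞)`-parametrised objects of `M` and natural transformations. -/
abbrev Tame (M : Type u) [Category.{v} M] := (IsTame M).FullSubcategory

/-- The map `Y^s ⨿_{X^s} X^t ⟶ Y^t` induced by a natural transformation `g : X ⟶ Y`, for
`s ≤ t`. -/
noncomputable def relativeTransition [HasPushouts M] {X Y : ℝ≥0 ⥤ M} (g : X ⟶ Y)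
    {s t : ℝ≥0} (h : s ≤ t) :
    pushout (g.app s) (X.map (homOfLE h)) ⟶ Y.obj t :=
  pushout.desc (Y.map (homOfLE h)) (g.app t) (g.naturality (homOfLE h)).symm

/-- The cofibrations of `Tame M`: `g : X ⟶ Y` is a cofibration if, for some sequence
`0 = τ 0 < ⋯ < τ k` discretising both `X` and `Y`, the map `X^0 ⟶ Y^0` and the maps
`Y^{τ a} ⨿_{X^{τ a}} X^{τ (a+1)} ⟶ Y^{τ (a+1)}` for `0 ≤ a < k` are cofibrations of `M`. -/
instance tameCategoryWithCofibrations [HasPushouts M] [CategoryWithCofibrations M] :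
    CategoryWithCofibrations (Tame M) where
  cofibrations := fun X Y g ↦
    ∃ (k : ℕ) (τ : Fin (k + 1) → ℝ≥0) (hτ : StrictMono τ),
      τ 0 = 0 ∧ Discretises τ X.obj ∧ Discretises τ Y.obj ∧
      Cofibration (g.hom.app (τ 0)) ∧
      ∀ a : Fin k, Cofibration
        (relativeTransition g.hom (hτ.monotone a.castSucc_lt_succ.le))

theorem isTame_of_finset {X : ℝ≥0 ⥤ M} (T : Finset ℝ≥0)
    (hT : ∀ ⦃s t : ℝ≥0⦄ (h : s ≤ t), (∀ a ∈ T, ¬ (s < a ∧ a ≤ t)) →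
      IsIso (X.map (homOfLE h))) : IsTame M X := by
  classical
  have hc : (insert 0 T).card = ((insert 0 T).card - 1) + 1 :=
    (Nat.sub_add_cancel (Finset.card_pos.2 ⟨0, by simp⟩)).symm
  refine ⟨_, (insert 0 T).orderEmbOfFin hc, ((insert 0 T).orderEmbOfFin hc).strictMono, ?_⟩
  intro s t h hst
  refine hT h fun a ha hsa ↦ hst ?_
  have : a ∈ Set.range ((insert 0 T).orderEmbOfFin hc) := by
    rw [Finset.range_orderEmbOfFin]
    simp [ha]
  obtain ⟨i, rfl⟩ := this
  exact ⟨i, hsa⟩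

instance isTame_isClosedUnderFiniteProducts [HasFiniteProducts M] :
    (IsTame M).IsClosedUnderFiniteProducts where
  isClosedUnderLimitsOfShape J _ := by
    classical
    have := Fintype.ofFinite J
    refine ⟨?_⟩
    rintro X ⟨p⟩
    choose k τ hτ hd using fun j : J ↦ p.prop_diag_obj ⟨j⟩
    refine isTame_of_finset (Finset.univ.biUnion fun j ↦ Finset.univ.image (τ j)) ?_
    intro s t h hst
    let F (r : ℝ≥0) := (evaluation ℝ≥0 M).obj r
    let φ : p.diag ⋙ F s ⟶ p.diag ⋙ F t :=
      Functor.whiskerLeft p.diag ((evaluation ℝ≥0 M).map (homOfLE h))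
    have hφ : ∀ j, IsIso (φ.app j) := by
      rintro ⟨j⟩
      refine hd j h ?_
      rintro ⟨a, ha⟩
      exact hst (τ j a) (by simp only [Finset.mem_biUnion, Finset.mem_image]; exact ⟨j, by simp, a, by simp, rfl⟩) ha
    have : IsIso φ := NatIso.isIso_of_isIso_app φ
    have hs := isLimitOfPreserves (F s) p.isLimit
    have ht := isLimitOfPreserves (F t) p.isLimit
    have key : X.map (homOfLE h) =
        (IsLimit.conePointsIsoOfNatIso hs ht (asIso φ)).hom := by
      refine ht.hom_ext fun j ↦ ?_
      rw [IsLimit.conePointsIsoOfNatIso_hom_comp]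
      exact (p.π.app j).naturality (homOfLE h)
    rw [key]
    infer_instance

open scoped ZeroObject in
instance isTame_containsZero [HasZeroMorphisms M] [HasZeroObject M] :
    (IsTame M).ContainsZero where
  exists_zero := by
    refine ⟨0, isZero_zero _, isTame_of_finset ∅ fun s t h _ ↦ ?_⟩
    have h0 (r : ℝ≥0) : IsZero ((0 : ℝ≥0 ⥤ M).obj r) :=
      (Functor.isZero_iff _).1 (isZero_zero _) r
    exact ⟨0, (h0 s).eq_of_src _ _, (h0 t).eq_of_src _ _⟩

instance tame_hasFiniteBiproducts [Preadditive M] [HasFiniteProducts M] :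
    HasFiniteBiproducts (Tame M) :=
  HasFiniteBiproducts.of_hasFiniteProducts

end Tame

/-! ### Compact chain complexes over a field -/

section Compact

variable (K : Type u) [Field K]

/-- A non-negatively graded chain complex `X` of `K`-vector spaces is compact if `⨁ₙ Xₙ` is
finite dimensional. -/
def IsCompactComplex : ObjectProperty (ChainComplex (ModuleCat.{u} K) ℕ) := fun X ↦
  FiniteDimensional K (⨁ n : ℕ, X.X n)

/-- The category of compact chain complexes over `K`. -/
abbrev CompactComplex := (IsCompactComplex K).FullSubcategory

variable {K}

theorem isCompactComplex_iff (X : ChainComplex (ModuleCat.{u} K) ℕ) :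
    IsCompactComplex K X ↔
      (∀ n, FiniteDimensional K (X.X n)) ∧ ∃ N, ∀ n, N ≤ n → Subsingleton (X.X n) := by
  classical
  constructor
  · intro (h : FiniteDimensional K (⨁ n : ℕ, X.X n))
    refine ⟨fun n ↦ FiniteDimensional.of_injective (DirectSum.lof K ℕ (fun n ↦ X.X n) n)
      (DirectSum.of_injective n), ?_⟩
    obtain ⟨S, hS⟩ := h.fg_top
    refine ⟨(S.biUnion fun x ↦ DFinsupp.support x).sup id + 1, fun n hn ↦ ?_⟩
    have h0 : ∀ x : (⨁ n : ℕ, X.X n), DirectSum.component K ℕ (fun n ↦ X.X n) n x = 0 := by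
      intro x
      have hx : x ∈ Submodule.span K (S : Set (⨁ n : ℕ, X.X n)) := hS ▸ Submodule.mem_top
      refine (Submodule.span_le (p := LinearMap.ker
        (DirectSum.component K ℕ (fun n ↦ X.X n) n))).2 ?_ hx
      intro y hy
      change y n = 0
      by_contra hne
      have : n ∈ S.biUnion fun x ↦ DFinsupp.support x :=
        Finset.mem_biUnion.2 ⟨y, hy, DFinsupp.mem_support_iff.2 hne⟩
      have := Finset.le_sup (f := id) this
      simp only [id] at this
      omega
    refine ⟨fun a b ↦ ?_⟩
    have ha := h0 (DirectSum.lof K ℕ _ n a)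
    have hb := h0 (DirectSum.lof K ℕ _ n b)
    rw [DirectSum.component.lof_self] at ha hb
    rw [ha, hb]
  · rintro ⟨h1, N, hN⟩
    change FiniteDimensional K (⨁ n : ℕ, X.X n)
    let f : (⨁ n : ℕ, X.X n) →ₗ[K] (∀ i : Fin N, X.X i) :=
      LinearMap.pi fun i ↦ DirectSum.component K ℕ (fun n ↦ X.X n) i
    refine FiniteDimensional.of_injective f fun x y hxy ↦ ?_
    refine DFinsupp.ext fun n ↦ ?_
    by_cases hn : n < N
    · exact congrFun hxy ⟨n, hn⟩
    · exact (hN n (not_lt.1 hn)).elim _ _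

open scoped ZeroObject in
instance isCompactComplex_containsZero : (IsCompactComplex K).ContainsZero where
  exists_zero := by
    have h (n : ℕ) : Subsingleton
        ((0 : ChainComplex (ModuleCat.{u} K) ℕ).X n) :=
      ModuleCat.subsingleton_of_isZero
        ((HomologicalComplex.eval _ _ n).map_isZero (isZero_zero _))
    exact ⟨0, isZero_zero _, (isCompactComplex_iff _).2
      ⟨fun n ↦ inferInstance, 0, fun n _ ↦ h n⟩⟩

instance isCompactComplex_isClosedUnderQuotients :
    (IsCompactComplex K).IsClosedUnderQuotients where
  prop_of_epi {X Y} f _ hX := by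
    rw [isCompactComplex_iff] at hX ⊢
    obtain ⟨h1, N, hN⟩ := hX
    have hf (n : ℕ) : Function.Surjective (f.f n) :=
      (ModuleCat.epi_iff_surjective (f.f n)).1 inferInstance
    exact ⟨fun n ↦ Module.Finite.of_surjective (f.f n).hom (hf n),
      N, fun n hn ↦ have := hN n hn; (hf n).subsingleton⟩

instance isCompactComplex_isClosedUnderSubobjects :
    (IsCompactComplex K).IsClosedUnderSubobjects where
  prop_of_mono {X Y} f _ hY := by
    rw [isCompactComplex_iff] at hY ⊢
    obtain ⟨h1, N, hN⟩ := hY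
    have hf (n : ℕ) : Function.Injective (f.f n) :=
      (ModuleCat.mono_iff_injective (f.f n)).1 inferInstance
    exact ⟨fun n ↦ FiniteDimensional.of_injective (f.f n).hom (hf n),
      N, fun n hn ↦ have := hN n hn; (hf n).subsingleton⟩

instance isCompactComplex_isClosedUnderFiniteProducts :
    (IsCompactComplex K).IsClosedUnderFiniteProducts where
  isClosedUnderLimitsOfShape J _ := by
    classical
    have := Fintype.ofFinite J
    refine ⟨?_⟩
    rintro X ⟨p⟩
    choose h1 N hN using fun j : J ↦ (isCompactComplex_iff _).1 (p.prop_diag_obj ⟨j⟩)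
    rw [isCompactComplex_iff]
    let π (n : ℕ) (j : J) : X.X n →ₗ[K] (p.diag.obj ⟨j⟩).X n := ((p.π.app ⟨j⟩).f n).hom
    have hinj (n : ℕ) : Function.Injective (LinearMap.pi (π n)) := by
      intro x y hxy
      refine Concrete.isLimit_ext _
        (isLimitOfPreserves (HomologicalComplex.eval _ _ n) p.isLimit) x y ?_
      rintro ⟨j⟩
      exact congrFun hxy j
    refine ⟨fun n ↦ FiniteDimensional.of_injective _ (hinj n),
      Finset.univ.sup N, fun n hn ↦ ?_⟩
    have (j : J) : Subsingleton ((p.diag.obj ⟨j⟩).X n) :=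
      hN j n ((Finset.le_sup (Finset.mem_univ j)).trans hn)
    exact (hinj n).subsingleton

variable (K)

/-- The cofibrations of compact chain complexes are the degreewise monomorphisms. -/
instance compactComplexCategoryWithCofibrations :
    CategoryWithCofibrations (CompactComplex K) where
  cofibrations := fun _ _ g ↦ ∀ n : ℕ, Mono (g.hom.f n)

/-! ### Interval spheres -/

/-- The submodule `K` of `K` if the proposition `p` holds, and `0` otherwise. -/
def lineIf (p : Prop) : Submodule K K where
  carrier := {x | p ∨ x = 0}
  zero_mem' := Or.inr rfl
  add_mem' := by
    rintro a b (h | rfl) (h' | rfl) <;> simp_all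
  smul_mem' := by
    rintro c a (h | rfl) <;> simp_all

theorem lineIf_mono {p q : Prop} (h : p → q) : lineIf K p ≤ lineIf K q :=
  fun _ hx ↦ hx.imp_left h

/-- The chain complex with `K` in degree `n` if `p` holds, `K` in degree `n + 1` if `q` holds,
zero in all the other places, and whose differential from degree `n + 1` to degree `n` is the
inclusion. For `p`, `q` true this is the disk `D^{n+1}`; for `p` true and `q` false it is the
sphere `S^n`; for `p`, `q` false it is zero. -/
def partialDisk (n : ℕ) (p q : Prop) (hqp : q → p) : ChainComplex (ModuleCat.{u} K) ℕ where
  X k := ModuleCat.of K (lineIf K ((k = n ∧ p) ∨ (k = n + 1 ∧ q)))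
  d i j := ModuleCat.ofHom <|
    (if i = n + 1 ∧ j = n then LinearMap.id else 0 : K →ₗ[K] K).restrict <| by
      intro x hx
      split_ifs with hij
      · obtain ⟨rfl, rfl⟩ := hij
        exact hx.imp_left fun h ↦ Or.inl ⟨rfl, by
          rcases h with h | h
          · omega
          · exact hqp h.2⟩
      · exact Submodule.zero_mem _
  shape i j hij := by
    ext x
    have : ¬ (i = n + 1 ∧ j = n) := by
      rintro ⟨rfl, rfl⟩
      exact hij rfl
    simp [this]
  d_comp_d' i j k _ _ := by
    refine ModuleCat.hom_ext (LinearMap.ext fun x ↦ Subtype.ext ?_)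
    by_cases hij : i = n + 1 ∧ j = n
    · have : ¬ (j = n + 1 ∧ k = n) := by omega
      simp [this]
    · simp [hij]

/-- The inclusion between two such complexes, when the first has fewer nonzero terms. -/
def partialDiskMap (n : ℕ) {p q p' q' : Prop} (hqp : q → p) (hqp' : q' → p')
    (hp : p → p') (hq : q → q') : partialDisk K n p q hqp ⟶ partialDisk K n p' q' hqp' where
  f k := ModuleCat.ofHom <| Submodule.inclusion <|
    lineIf_mono K (Or.imp (And.imp_right hp) (And.imp_right hq))
  comm' i j _ := by
    ext x
    rfl

variable {K} in
theorem isCompactComplex_partialDisk (n : ℕ) (p q : Prop) (hqp : q → p) :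
    IsCompactComplex K (partialDisk K n p q hqp) := by
  rw [isCompactComplex_iff]
  refine ⟨fun k ↦ inferInstanceAs (FiniteDimensional K (lineIf K _)), n + 2, fun k hk ↦ ?_⟩
  refine ⟨fun x y ↦ Subtype.ext ?_⟩
  have h (z : (partialDisk K n p q hqp).X k) : z.1 = 0 := by
    rcases z.2 with h | h
    · omega
    · exact h
  rw [h x, h y]

theorem coe_le_of_coe_le {s t : ℝ≥0} {e : ℝ≥0∞} (hse : (s : ℝ≥0∞) ≤ e)
    (h : e ≤ (t : ℝ≥0∞)) : s ≤ t :=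
  ENNReal.coe_le_coe.1 (hse.trans h)

/-- The functor underlying an interval sphere. -/
def intervalSphereFunctor (n : ℕ) (s : ℝ≥0) (e : ℝ≥0∞) (hse : (s : ℝ≥0∞) ≤ e) :
    ℝ≥0 ⥤ CompactComplex K where
  obj t := ⟨partialDisk K n (s ≤ t) (e ≤ (t : ℝ≥0∞))
    (coe_le_of_coe_le hse), isCompactComplex_partialDisk _ _ _ _⟩
  map f := ObjectProperty.homMk <| partialDiskMap K n
    (coe_le_of_coe_le hse) (coe_le_of_coe_le hse) (fun h ↦ h.trans (leOfHom f))
    (fun h ↦ h.trans (ENNReal.coe_le_coe.2 (leOfHom f)))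
  map_id _ := rfl
  map_comp _ _ := rfl

/-- The interval sphere `S^n[s,e)`: its value at `t` is `0` for `t < s`, the sphere `S^n` for
`s ≤ t < e` and the disk `D^{n+1}` for `e ≤ t`, and its transitions are the inclusions.
(Thus the middle range is empty if `s = e`, and the last one is empty if `e = ∞`.) -/
def intervalSphere (n : ℕ) (s : ℝ≥0) (e : ℝ≥0∞) (hse : (s : ℝ≥0∞) ≤ e) :
    Tame (CompactComplex K) where
  obj := intervalSphereFunctor K n s e hse
  property := by
    refine isTame_of_finset {s, e.toNNReal} fun a b h hab ↦ ?_
    have hs : s ≤ b → s ≤ a := fun hb ↦ by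
      by_contra ha
      exact hab s (by simp) ⟨not_le.1 ha, hb⟩
    have he : e ≤ (b : ℝ≥0∞) → e ≤ (a : ℝ≥0∞) := fun hb ↦ by
      have hfin : (e.toNNReal : ℝ≥0∞) = e :=
        ENNReal.coe_toNNReal (hb.trans_lt ENNReal.coe_lt_top).ne
      by_contra ha
      rw [← hfin, ENNReal.coe_le_coe] at ha hb
      exact hab e.toNNReal (by simp) ⟨not_le.1 ha, hb⟩
    exact ⟨ObjectProperty.homMk (partialDiskMap K n
      (coe_le_of_coe_le hse) (coe_le_of_coe_le hse) hs he), rfl, rfl⟩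

end Compact

/-! Existence. Cofibrancy turns `X` into a filtration of the complex `C = X^T`, with `T` the last
jump, by subcomplexes that change at finitely many times only. It is enough to split off one
interval sphere and to induct on the total dimension of `C`. Let `e` be the earliest time at which
some differential is nonzero, `y` a chain of `X^e` with `x = dy ≠ 0` in degree `n`, and `s` the time
at which `x` enters the filtration. Over a field some linear form `φ` on `C_n` has `φ x = 1` and
kills everything present before `s`. Then `φ` in degree `n` and `φ ∘ d` in degree `n + 1` form a
chain map `C → D^{n+1}`. It respects the filtrations because all differentials vanish before `e`, so
it retracts `X` onto the copy of `S^n[s,e)` spanned by `x` and `y`. If no differential is ever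
nonzero, any `x ≠ 0` works with `e = ∞`. This is `IsFiniteFiltration.exists_retract`; the induction
is `IsFiniteFiltration.exists_decomposition`.

Uniqueness. A morphism of interval spheres acts on the bottom generator by a scalar, and this scalar
is multiplicative. A nonzero scalar forces equal dimensions and lets neither birth nor death
increase (`Bar.le_of_scalar_ne_zero`). So a composite from a bar back to an equal bar with nonzero
scalars passes only through that same bar. An isomorphism of sums therefore restricts, for each bar,
to scalar matrices with product the identity, and ranks compare the multiplicities
(`Bar.card_fiber_le`). -/

/-! ### Compact complexes in terms of elements and linear maps -/

section DegreewiseMaps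

variable {K : Type u} [Field K]

/-- The linear map in degree `k` underlying a morphism of compact complexes. -/
def degreeMap {X Y : CompactComplex K} (f : X ⟶ Y) (k : ℕ) : X.obj.X k →ₗ[K] Y.obj.X k :=
  (f.hom.f k).hom

/-- The differential of a compact complex as a linear map. -/
def differential (X : CompactComplex K) (i j : ℕ) : X.obj.X i →ₗ[K] X.obj.X j :=
  (X.obj.d i j).hom

theorem degreeMap_id (X : CompactComplex K) (k : ℕ) (x : X.obj.X k) :
    degreeMap (𝟙 X) k x = x := rfl

theorem degreeMap_comp {X Y Z : CompactComplex K} (f : X ⟶ Y) (g : Y ⟶ Z) (k : ℕ)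
    (x : X.obj.X k) : degreeMap (f ≫ g) k x = degreeMap g k (degreeMap f k x) := rfl

theorem degreeMap_differential {X Y : CompactComplex K} (f : X ⟶ Y) (i j : ℕ) (x : X.obj.X i) :
    degreeMap f j (differential X i j x) = differential Y i j (degreeMap f i x) :=
  (ConcreteCategory.congr_hom (f.hom.comm i j) x).symm

theorem differential_comp_differential (X : CompactComplex K) (i j k : ℕ) (x : X.obj.X i) :
    differential X j k (differential X i j x) = 0 :=
  ConcreteCategory.congr_hom (X.obj.d_comp_d i j k) x

theorem differential_shape (X : CompactComplex K) {i j : ℕ} (h : i ≠ j + 1) (x : X.obj.X i) :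
    differential X i j x = 0 :=
  ConcreteCategory.congr_hom (X.obj.shape i j fun h' ↦ h h'.symm) x

theorem compactComplex_hom_ext {X Y : CompactComplex K} {f g : X ⟶ Y}
    (h : ∀ k x, degreeMap f k x = degreeMap g k x) : f = g := by
  refine ObjectProperty.hom_ext _ (HomologicalComplex.hom_ext _ _ fun k ↦ ?_)
  exact ModuleCat.hom_ext (LinearMap.ext (h k))

/-- A morphism of compact complexes from a family of linear maps commuting with the
differentials. -/
def compactComplexHomMk {X Y : CompactComplex K} (f : ∀ k, X.obj.X k →ₗ[K] Y.obj.X k)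
    (hf : ∀ i j x, differential Y i j (f i x) = f j (differential X i j x)) : X ⟶ Y :=
  ObjectProperty.homMk
    { f := fun k ↦ ModuleCat.ofHom (f k)
      comm' := fun i j _ ↦ ModuleCat.hom_ext (LinearMap.ext (hf i j)) }

theorem degreeMap_naturality {X Y : ℝ≥0 ⥤ CompactComplex K} (f : X ⟶ Y) {s t : ℝ≥0}
    (h : s ⟶ t) (k : ℕ) (x : (X.obj s).obj.X k) :
    degreeMap (f.app t) k (degreeMap (X.map h) k x) =
      degreeMap (Y.map h) k (degreeMap (f.app s) k x) := by
  rw [← degreeMap_comp, ← degreeMap_comp, f.naturality]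

end DegreewiseMaps

/-! ### Interval spheres and the scalar of a morphism between them -/

section Bars

/-- The parameters of an interval sphere. -/
@[ext]
structure Bar where
  /-- The dimension of the sphere. -/
  n : ℕ
  /-- The time of birth. -/
  s : ℝ≥0
  /-- The time of death. -/
  e : ℝ≥0∞
  hse : (s : ℝ≥0∞) ≤ e

/-- The interval sphere with parameters `b` is nonzero in degree `k` at time `t`. -/
def Bar.Active (b : Bar) (t : ℝ≥0) (k : ℕ) : Prop :=
  (k = b.n ∧ b.s ≤ t) ∨ (k = b.n + 1 ∧ b.e ≤ (t : ℝ≥0∞))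

theorem Bar.Active.s_le {b : Bar} {t : ℝ≥0} {k : ℕ} (h : b.Active t k) : b.s ≤ t :=
  h.elim And.right fun h ↦ coe_le_of_coe_le b.hse h.2

theorem Bar.active_self (b : Bar) : b.Active b.s b.n := Or.inl ⟨rfl, le_rfl⟩

variable (K : Type u) [Field K]

/-- The functor underlying the interval sphere with parameters `b`. -/
abbrev Bar.sphere (b : Bar) : ℝ≥0 ⥤ CompactComplex K :=
  intervalSphereFunctor K b.n b.s b.e b.hse

variable {K}

namespace Bar

/-- The coordinate of an element of an interval sphere. -/
def coord (b : Bar) (t : ℝ≥0) (k : ℕ) : ((b.sphere K).obj t).obj.X k →ₗ[K] K :=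
  Submodule.subtype (lineIf K (b.Active t k))

/-- The element of an interval sphere with coordinate one. -/
def gen {b : Bar} {t : ℝ≥0} {k : ℕ} (h : b.Active t k) : ((b.sphere K).obj t).obj.X k :=
  (⟨1, Or.inl h⟩ : lineIf K (b.Active t k))

theorem coord_gen {b : Bar} {t : ℝ≥0} {k : ℕ} (h : b.Active t k) :
    b.coord t k (gen h : ((b.sphere K).obj t).obj.X k) = 1 := rfl

theorem coord_injective (b : Bar) (t : ℝ≥0) (k : ℕ) :
    Function.Injective (b.coord (K := K) t k) := Subtype.coe_injective

theorem active_or_coord_eq_zero {b : Bar} {t : ℝ≥0} {k : ℕ}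
    (x : ((b.sphere K).obj t).obj.X k) : b.Active t k ∨ b.coord t k x = 0 :=
  (show lineIf K (b.Active t k) from x).2

theorem coord_map {b : Bar} {t t' : ℝ≥0} (h : t ⟶ t') {k : ℕ}
    (x : ((b.sphere K).obj t).obj.X k) :
    b.coord t' k (degreeMap ((b.sphere K).map h) k x) = b.coord t k x := rfl

theorem coord_differential (b : Bar) (t : ℝ≥0) (i j : ℕ) (x : ((b.sphere K).obj t).obj.X i) :
    b.coord t j (differential _ i j x) = if i = b.n + 1 ∧ j = b.n then b.coord t i x else 0 := by
  by_cases h : i = b.n + 1 ∧ j = b.n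
  · rw [if_pos h]
    change (if i = b.n + 1 ∧ j = b.n then LinearMap.id else 0 : K →ₗ[K] K) (b.coord t i x) = _
    rw [if_pos h]; rfl
  · rw [if_neg h]
    change (if i = b.n + 1 ∧ j = b.n then LinearMap.id else 0 : K →ₗ[K] K) (b.coord t i x) = _
    rw [if_neg h]; rfl

/-- The scalar by which a morphism of interval spheres acts on the bottom generator. -/
def scalar {b b' : Bar} (f : b.sphere K ⟶ b'.sphere K) : K :=
  b'.coord b.s b.n (degreeMap (f.app b.s) b.n (gen b.active_self))

theorem scalar_id (b : Bar) : scalar (𝟙 (b.sphere K)) = 1 := rfl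

theorem scalar_zero (b b' : Bar) : scalar (0 : b.sphere K ⟶ b'.sphere K) = 0 := rfl

theorem scalar_add {b b' : Bar} (f g : b.sphere K ⟶ b'.sphere K) :
    scalar (f + g) = scalar f + scalar g := rfl

theorem scalar_sum {b b' : Bar} {ι : Type*} (S : Finset ι) (f : ι → (b.sphere K ⟶ b'.sphere K)) :
    scalar (∑ i ∈ S, f i) = ∑ i ∈ S, scalar (f i) :=
  map_sum (AddMonoidHom.mk' (scalar (K := K)) scalar_add) f S

/-- A morphism of interval spheres multiplies the coordinate in the bottom degree by its scalar. -/
theorem coord_app {b b' : Bar} (f : b.sphere K ⟶ b'.sphere K) {t : ℝ≥0} (ht : b.s ≤ t) {k : ℕ}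
    (hk : k = b.n) (x : ((b.sphere K).obj t).obj.X k) :
    b'.coord t k (degreeMap (f.app t) k x) = b.coord t k x * scalar f := by
  subst hk
  -- In the bottom degree every element is a multiple of the generator transported from birth, so
  -- naturality reduces the claim to time `b.s`.
  have hx : x = b.coord t b.n x •
      degreeMap ((b.sphere K).map (homOfLE ht)) b.n (gen b.active_self) := by
    apply b.coord_injective t
    rw [map_smul, coord_map, coord_gen, smul_eq_mul, mul_one]
  conv_lhs => rw [hx]
  rw [map_smul, map_smul, smul_eq_mul, degreeMap_naturality, coord_map, scalar]

/-- Cycles go to cycles and boundaries to boundaries. The bottom generator is a cycle, so its image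
cannot be a nonzero top cell of a disk, which fixes the dimension. The target must be alive when the
generator is born, and once the generator bounds, its image must bound too. -/
theorem le_of_scalar_ne_zero {b b' : Bar} (f : b.sphere K ⟶ b'.sphere K) (hf : scalar f ≠ 0) :
    b.n = b'.n ∧ b'.s ≤ b.s ∧ b'.e ≤ b.e := by
  -- For `b.n = 0` the subtraction truncates and this is the map from degree 0 to itself, which is
  -- zero as well.
  have hd : differential _ b.n (b.n - 1) (gen (K := K) b.active_self) = 0 := by
    apply b.coord_injective
    rw [coord_differential, if_neg (by omega), map_zero]
  have hn : b.n = b'.n := by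
    rcases (active_or_coord_eq_zero _).resolve_right hf with h | h
    · exact h.1
    · refine absurd ?_ hf
      have h2 := degreeMap_differential (f.app b.s) b.n (b.n - 1) (gen b.active_self)
      have h3 := congrArg (b'.coord b.s (b.n - 1)) h2
      rw [hd, map_zero, map_zero, coord_differential, if_pos (by omega)] at h3
      exact h3.symm
  refine ⟨hn, ((active_or_coord_eq_zero _).resolve_right hf).s_le, ?_⟩
  rcases eq_or_ne b.e ⊤ with he | he
  · rw [he]; exact le_top
  lift b.e to ℝ≥0 using he with t ht
  have hact : b.Active t (b.n + 1) := Or.inr ⟨rfl, ht.ge⟩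
  have hst : b.s ≤ t := hact.s_le
  have h1 := degreeMap_differential (f.app t) (b.n + 1) b.n (gen hact)
  have h2 := congrArg (b'.coord t b.n) h1
  rw [coord_app f hst rfl, coord_differential, if_pos ⟨rfl, rfl⟩, coord_gen, one_mul,
    coord_differential, if_pos (by omega)] at h2
  rw [h2] at hf
  rcases (active_or_coord_eq_zero _).resolve_right hf with h | h
  · omega
  · exact h.2

/-- Either `f` kills the bottom generator, or its image lies in the bottom degree of the middle
sphere, where `g` acts by its scalar. -/
theorem scalar_comp {b b' b'' : Bar} (f : b.sphere K ⟶ b'.sphere K)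
    (g : b'.sphere K ⟶ b''.sphere K) : scalar (f ≫ g) = scalar f * scalar g := by
  by_cases hf : scalar f = 0
  · have h0 : degreeMap (f.app b.s) b.n (gen b.active_self) = 0 := by
      apply b'.coord_injective
      rw [map_zero]
      exact hf
    rw [hf, zero_mul, scalar, NatTrans.comp_app, degreeMap_comp, h0, map_zero, map_zero]
  · obtain ⟨hn, hs, -⟩ := le_of_scalar_ne_zero f hf
    exact coord_app g hs hn _

end Bar

end Bars

/-! ### Multiplicities of bars are isomorphism invariants -/

section Uniqueness

theorem Matrix.card_le_card_of_mul_eq_one {K : Type*} [Field K] {m n : Type*} [Fintype m]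
    [Fintype n] [DecidableEq m] (A : Matrix m n K) (B : Matrix n m K) (h : A * B = 1) :
    Fintype.card m ≤ Fintype.card n := by
  have h1 := Matrix.rank_mul_le_left A B
  rw [h, Matrix.rank_one] at h1
  exact h1.trans (Matrix.rank_le_card_width A)

variable {K : Type u} [Field K]

/-- Morphisms between finite families of interval spheres that compose to the identity
matrix on the first family: each bar occurs in the second family at least as often. -/
theorem Bar.card_fiber_le {I J : Type*} [Fintype I] [Fintype J] [DecidableEq I]
    (b : I → Bar) (b' : J → Bar)
    (f : ∀ i j, (b i).sphere K ⟶ (b' j).sphere K) (g : ∀ j i, (b' j).sphere K ⟶ (b i).sphere K)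
    (h1 : ∀ i, ∑ j, f i j ≫ g j i = 𝟙 _) (h0 : ∀ i i', i ≠ i' → ∑ j, f i j ≫ g j i' = 0)
    (c : Bar) : Nat.card {i // b i = c} ≤ Nat.card {j // b' j = c} := by
  classical
  rw [Nat.card_eq_fintype_card, Nat.card_eq_fintype_card]
  refine Matrix.card_le_card_of_mul_eq_one (K := K)
    (Matrix.of fun (i : {i // b i = c}) (j : {j // b' j = c}) ↦ scalar (f i j))
    (Matrix.of fun (j : {j // b' j = c}) (i : {i // b i = c}) ↦ scalar (g j i)) ?_
  ext ⟨i, hi⟩ ⟨i', hi'⟩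
  have hsum : ∑ j : {j // b' j = c}, scalar (f i j) * scalar (g j i') =
      scalar (∑ j, f i j ≫ g j i') := by
    rw [scalar_sum]
    simp only [scalar_comp]
    rw [← Finset.sum_subset (Finset.subset_univ (Finset.univ.filter fun j ↦ b' j = c)),
      Finset.sum_subtype (p := fun j ↦ b' j = c) _ (by simp)]
    -- Bars other than `c` contribute nothing: two nonzero scalars bound the parameters of `b' j` by
    -- those of `c` from both sides.
    intro j _ hj
    by_contra hne
    refine hj (Finset.mem_filter.2 ⟨Finset.mem_univ _, ?_⟩)
    have h2 := le_of_scalar_ne_zero _ (left_ne_zero_of_mul hne)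
    have h3 := le_of_scalar_ne_zero _ (right_ne_zero_of_mul hne)
    rw [hi] at h2
    rw [hi'] at h3
    exact Bar.ext h3.1 (h2.2.1.antisymm h3.2.1) (h2.2.2.antisymm h3.2.2)
  rw [Matrix.mul_apply]
  simp only [Matrix.of_apply]
  rw [hsum]
  by_cases hii : i = i'
  · subst hii
    rw [h1, scalar_id, Matrix.one_apply_eq]
  · rw [h0 _ _ hii, scalar_zero, Matrix.one_apply_ne (by simpa using hii)]

/-- The interval sphere with parameters `b` as a tame functor. -/
abbrev Bar.tameSphere (K : Type u) [Field K] (b : Bar) : Tame (CompactComplex K) :=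
  intervalSphere K b.n b.s b.e b.hse

theorem tame_sum_hom {X Y : Tame (CompactComplex K)} {J : Type*} (S : Finset J)
    (f : J → (X ⟶ Y)) : (∑ j ∈ S, f j).hom = ∑ j ∈ S, (f j).hom :=
  (IsTame (CompactComplex K)).ι.map_sum f S

theorem Bar.card_fiber_le_of_iso {l l' : ℕ} (b : Fin l → Bar) (b' : Fin l' → Bar)
    (φ : (⨁ fun i ↦ (b i).tameSphere K) ≅ ⨁ fun j ↦ (b' j).tameSphere K) (c : Bar) :
    Nat.card {i // b i = c} ≤ Nat.card {j // b' j = c} := by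
  have key (i i' : Fin l) :
      ∑ j, (biproduct.ι (fun i ↦ (b i).tameSphere K) i ≫ φ.hom ≫
          biproduct.π (fun j ↦ (b' j).tameSphere K) j).hom ≫
        (biproduct.ι (fun j ↦ (b' j).tameSphere K) j ≫ φ.inv ≫
          biproduct.π (fun i ↦ (b i).tameSphere K) i').hom =
      (biproduct.ι (fun i ↦ (b i).tameSphere K) i ≫
        biproduct.π (fun i ↦ (b i).tameSphere K) i').hom := by
    have h : ∑ j, (biproduct.ι (fun i ↦ (b i).tameSphere K) i ≫ φ.hom ≫
          biproduct.π (fun j ↦ (b' j).tameSphere K) j) ≫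
        (biproduct.ι (fun j ↦ (b' j).tameSphere K) j ≫ φ.inv ≫
          biproduct.π (fun i ↦ (b i).tameSphere K) i') =
      biproduct.ι (fun i ↦ (b i).tameSphere K) i ≫
        biproduct.π (fun i ↦ (b i).tameSphere K) i' := by
      -- The identity of the middle biproduct, written as a sum over its summands, is inserted
      -- between `φ.hom` and `φ.inv`.
      have h2 := congrArg (fun x ↦ biproduct.ι (fun i ↦ (b i).tameSphere K) i ≫ φ.hom ≫ x ≫
        φ.inv ≫ biproduct.π (fun i ↦ (b i).tameSphere K) i')
        (biproduct.total (f := fun j ↦ (b' j).tameSphere K))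
      simpa only [Preadditive.sum_comp, Preadditive.comp_sum, Category.assoc, Category.id_comp,
        Iso.hom_inv_id_assoc] using h2
    rw [← h, tame_sum_hom]
    rfl
  refine Bar.card_fiber_le b b' _ (fun j i' ↦ (biproduct.ι (fun j ↦ (b' j).tameSphere K) j ≫
    φ.inv ≫ biproduct.π (fun i ↦ (b i).tameSphere K) i').hom) (fun i ↦ (key i i).trans ?_)
    (fun i i' hii ↦ (key i i').trans ?_) c
  · rw [biproduct.ι_π_self]; rfl
  · rw [biproduct.ι_π_ne _ hii]; rfl

theorem Bar.exists_equiv_of_iso {l l' : ℕ} (b : Fin l → Bar) (b' : Fin l' → Bar)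
    (φ : (⨁ fun i ↦ (b i).tameSphere K) ≅ ⨁ fun j ↦ (b' j).tameSphere K) :
    ∃ σ : Fin l ≃ Fin l', ∀ i, b i = b' (σ i) := by
  have h (c : Bar) : Nonempty ({i // b i = c} ≃ {j // b' j = c}) :=
    Finite.card_eq.1 ((card_fiber_le_of_iso b b' φ c).antisymm (card_fiber_le_of_iso b' b φ.symm c))
  exact ⟨Equiv.ofFiberEquiv fun c ↦ (h c).some, fun i ↦ (Equiv.ofFiberEquiv_map _ i).symm⟩

end Uniqueness

/-! ### Criteria for an interval sphere to be a retract -/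

section Splitting

variable {K : Type u} [Field K] {X : ℝ≥0 ⥤ CompactComplex K} {C : CompactComplex K}

/-- A sufficient condition for an interval sphere to be a retract of a functor `X` whose values
embed compatibly into a complex `C`, in terms of elements and linear forms of `C`. -/
theorem Bar.exists_retract_of_families (g : ∀ t, X.obj t ⟶ C)
    (hg : ∀ ⦃s t : ℝ≥0⦄ (h : s ⟶ t), X.map h ≫ g t = g s)
    (hinj : ∀ t k, Function.Injective (degreeMap (g t) k)) (b : Bar)
    (w : ∀ k, C.obj.X k) (ψ : ∀ k, C.obj.X k →ₗ[K] K)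
    (hw : ∀ t k, b.Active t k → ∃ v, degreeMap (g t) k v = w k)
    (hdw : ∀ t i j, b.Active t i →
      differential C i j (w i) = if i = b.n + 1 ∧ j = b.n then w j else 0)
    (hψ : ∀ t k, b.Active t k ∨ ∀ x, ψ k (degreeMap (g t) k x) = 0)
    (hψd : ∀ i j x, ψ j (differential C i j x) = if i = b.n + 1 ∧ j = b.n then ψ i x else 0)
    (h1 : ∀ t k, b.Active t k → ψ k (w k) = 1) :
    ∃ (i : b.sphere K ⟶ X) (r : X ⟶ b.sphere K), i ≫ r = 𝟙 _ := by
  -- The value 0 at inactive places is harmless, since the coordinate multiplying it vanishes there.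
  have hv (t k) : ∃ v, b.Active t k → degreeMap (g t) k v = w k := by
    by_cases h : b.Active t k
    · exact (hw t k h).imp fun _ hv _ ↦ hv
    · exact ⟨0, fun h' ↦ absurd h' h⟩
  choose v hv using hv
  have hgv (t k) (c : ((b.sphere K).obj t).obj.X k) :
      degreeMap (g t) k (b.coord t k c • v t k) = b.coord t k c • w k := by
    rw [map_smul]
    rcases active_or_coord_eq_zero c with h | h
    · rw [hv t k h]
    · rw [h, zero_smul, zero_smul]
  let i : b.sphere K ⟶ X :=
    { app := fun t ↦ compactComplexHomMk
        (fun k ↦ (LinearMap.toSpanSingleton K _ (v t k)).comp (b.coord t k)) <| by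
          intro i j c
          apply hinj t j
          change degreeMap (g t) j (differential _ i j (b.coord t i c • v t i)) =
            degreeMap (g t) j
              (b.coord t j (differential ((b.sphere K).obj t) i j c) • v t j)
          rw [degreeMap_differential, hgv, hgv, coord_differential, map_smul]
          rcases active_or_coord_eq_zero c with h | h
          · rw [hdw t i j h]
            split_ifs <;> simp
          · simp [h]
      naturality := fun s t f ↦ by
        refine compactComplex_hom_ext fun k c ↦ hinj t k ?_
        rw [degreeMap_comp, degreeMap_comp, ← degreeMap_comp (X.map f), hg]
        exact (hgv t k (degreeMap ((b.sphere K).map f) k c)).trans (hgv s k c).symm }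
  let r : X ⟶ b.sphere K :=
    { app := fun t ↦ compactComplexHomMk
        (fun k ↦ ((ψ k).comp (degreeMap (g t) k)).codRestrict (lineIf K (b.Active t k))
          fun x ↦ (hψ t k).imp_right fun h ↦ h x) <| by
          intro i j x
          apply b.coord_injective
          rw [coord_differential]
          change _ = ψ j (degreeMap (g t) j _)
          rw [degreeMap_differential, hψd]
          rfl
      naturality := fun s t f ↦ by
        refine compactComplex_hom_ext fun k x ↦ b.coord_injective t k ?_
        change ψ k (degreeMap (X.map f ≫ g t) k x) = ψ k (degreeMap (g s) k x)
        rw [hg] }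
  refine ⟨i, r, NatTrans.ext (funext fun t ↦ compactComplex_hom_ext fun k c ↦ ?_)⟩
  apply b.coord_injective
  change ψ k (degreeMap (g t) k (b.coord t k c • v t k)) = b.coord t k c
  rw [hgv, map_smul, smul_eq_mul]
  rcases active_or_coord_eq_zero c with h | h
  · rw [h1 t k h, mul_one]
  · rw [h, zero_mul]

/-- The sphere is spanned by `x` and, from time `b.e` on, by `y`. The form in degree `b.n + 1` has
to be `φ ∘ d` for the retraction to be a chain map; it vanishes on boundaries because `d ∘ d = 0`.
When `b.e = ⊤` the element `y` plays no role. -/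
theorem Bar.exists_retract_of_generators (g : ∀ t, X.obj t ⟶ C)
    (hg : ∀ ⦃s t : ℝ≥0⦄ (h : s ⟶ t), X.map h ≫ g t = g s)
    (hinj : ∀ t k, Function.Injective (degreeMap (g t) k)) (b : Bar)
    (x : C.obj.X b.n) (y : C.obj.X (b.n + 1)) (φ : C.obj.X b.n →ₗ[K] K)
    (hx : ∃ v, degreeMap (g b.s) b.n v = x)
    (hy : ∀ t : ℝ≥0, b.e ≤ t → ∃ v, degreeMap (g t) (b.n + 1) v = y)
    (hdx : ∀ j, differential C b.n j x = 0)
    (hdy : b.e ≠ ⊤ → differential C (b.n + 1) b.n y = x)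
    (hφ : ∀ t < b.s, ∀ z, φ (degreeMap (g t) b.n z) = 0)
    (hφd : ∀ t : ℝ≥0, t < b.e → ∀ z : (X.obj t).obj.X (b.n + 1),
      φ (differential C (b.n + 1) b.n (degreeMap (g t) (b.n + 1) z)) = 0)
    (hφx : φ x = 1) :
    ∃ (i : b.sphere K ⟶ X) (r : X ⟶ b.sphere K), i ≫ r = 𝟙 _ := by
  let w : ∀ k, C.obj.X k := Function.update (Function.update 0 b.n x) (b.n + 1) y
  let ψ : ∀ k, C.obj.X k →ₗ[K] K := Function.update (Function.update 0 b.n φ) (b.n + 1)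
    (φ.comp (differential C (b.n + 1) b.n))
  have hw0 : w b.n = x := by simp [w]
  have hw1 : w (b.n + 1) = y := by simp [w]
  have hψ0 : ψ b.n = φ := by simp [ψ]
  have hψ1 : ψ (b.n + 1) = φ.comp (differential C (b.n + 1) b.n) := by simp [ψ]
  have hψ2 (k) (hk : k ≠ b.n) (hk' : k ≠ b.n + 1) : ψ k = 0 := by
    simp [ψ, Function.update_of_ne hk', Function.update_of_ne hk]
  have htop {t : ℝ≥0} (h : b.e ≤ t) : b.e ≠ ⊤ := (h.trans_lt ENNReal.coe_lt_top).ne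
  refine exists_retract_of_families g hg hinj b w ψ ?_ ?_ ?_ ?_ ?_
  · rintro t k (⟨rfl, h⟩ | ⟨rfl, h⟩)
    · obtain ⟨v, hv⟩ := hx
      rw [hw0]
      refine ⟨degreeMap (X.map (homOfLE h)) _ v, ?_⟩
      rw [← degreeMap_comp, hg, hv]
    · rw [hw1]
      exact hy t h
  · rintro t i j (⟨rfl, h⟩ | ⟨rfl, h⟩)
    · rw [hw0, hdx, if_neg (by omega)]
    · rw [hw1]
      split_ifs with hj
      · obtain ⟨-, rfl⟩ := hj
        rw [hdy (htop h), hw0]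
      · exact differential_shape C (by omega) y
  · intro t k
    by_cases hk : k = b.n
    · subst hk
      rw [hψ0]
      rcases le_or_gt b.s t with h | h
      · exact Or.inl (Or.inl ⟨rfl, h⟩)
      · exact Or.inr (hφ t h)
    by_cases hk' : k = b.n + 1
    · subst hk'
      rw [hψ1]
      rcases le_or_gt b.e t with h | h
      · exact Or.inl (Or.inr ⟨rfl, h⟩)
      · exact Or.inr (hφd t h)
    · rw [hψ2 k hk hk']
      exact Or.inr fun _ ↦ rfl
  · intro i j z
    split_ifs with hij
    · obtain ⟨rfl, rfl⟩ := hij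
      rw [hψ0, hψ1]; rfl
    · by_cases hj : j = b.n
      · rw [differential_shape C (by omega), map_zero]
      by_cases hj' : j = b.n + 1
      · subst hj'
        rw [hψ1, LinearMap.comp_apply, differential_comp_differential, map_zero]
      · rw [hψ2 j hj hj']; rfl
  · rintro t k (⟨rfl, h⟩ | ⟨rfl, h⟩)
    · rw [hψ0, hw0, hφx]
    · rw [hψ1, hw1, LinearMap.comp_apply, hdy (htop h), hφx]

/-! ### Splitting a finite filtration into interval spheres -/

/-- A functor on `[0,∞)` with values in compact complexes whose transitions are monomorphisms
in every degree, and isomorphisms except across the points of the finite set `F`. -/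
structure IsFiniteFiltration (F : Finset ℝ≥0) (X : ℝ≥0 ⥤ CompactComplex K) : Prop where
  zero_mem : 0 ∈ F
  isIso : ∀ ⦃s t : ℝ≥0⦄ (h : s ≤ t), (∀ a ∈ F, ¬ (s < a ∧ a ≤ t)) → IsIso (X.map (homOfLE h))
  injective : ∀ ⦃s t : ℝ≥0⦄ (h : s ⟶ t) (k : ℕ), Function.Injective (degreeMap (X.map h) k)

/-- A property that passes down within the cells cut out by `F` can be moved back to the left
endpoint of its cell. These endpoints lie in the finite set `F`, so the infimum is attained. This
produces the birth and death times. -/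
theorem exists_least_of_finset {F : Finset ℝ≥0} (h0 : 0 ∈ F) {P : ℝ≥0 → Prop}
    (hP : ∀ ⦃s t : ℝ≥0⦄, s ≤ t → (∀ a ∈ F, ¬ (s < a ∧ a ≤ t)) → P t → P s) (hex : ∃ t, P t) :
    ∃ s, P s ∧ ∀ t, P t → s ≤ t := by
  classical
  have key (t : ℝ≥0) (ht : P t) : ∃ c ∈ F, c ≤ t ∧ P c := by
    obtain ⟨c, hc⟩ := (F.filter (· ≤ t)).exists_maximal ⟨0, by simp [h0]⟩
    have hct := Finset.mem_filter.1 hc.prop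
    refine ⟨c, hct.1, hct.2, hP hct.2 (fun a ha hat ↦ ?_) ht⟩
    exact hat.1.not_ge (hc.le_of_ge (Finset.mem_filter.2 ⟨ha, hat.2⟩) hat.1.le)
  obtain ⟨t, ht⟩ := hex
  obtain ⟨c, hcF, -, hc⟩ := key t ht
  obtain ⟨m, hm⟩ := (F.filter P).exists_minimal ⟨c, Finset.mem_filter.2 ⟨hcF, hc⟩⟩
  refine ⟨m, (Finset.mem_filter.1 hm.prop).2, fun t ht ↦ ?_⟩
  obtain ⟨c, hcF, hct, hc⟩ := key t ht
  rcases le_total m c with h | h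
  · exact h.trans hct
  · exact (hm.le_of_le (Finset.mem_filter.2 ⟨hcF, hc⟩) h).trans hct

theorem degreeMap_surjective {X Y : CompactComplex K} (f : X ⟶ Y) [IsIso f] (k : ℕ) :
    Function.Surjective (degreeMap f k) := fun y ↦
  ⟨degreeMap (inv f) k y, by rw [← degreeMap_comp, IsIso.inv_hom_id, degreeMap_id]⟩

theorem degreeMap_injective {X Y : CompactComplex K} (f : X ⟶ Y) [IsIso f] (k : ℕ) :
    Function.Injective (degreeMap f k) :=
  Function.LeftInverse.injective (g := degreeMap (inv f) k) fun x ↦ by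
    rw [← degreeMap_comp, IsIso.hom_inv_id, degreeMap_id]

/-- The terminal value of a finite filtration receives a compatible family of embeddings. -/
theorem IsFiniteFiltration.exists_embedding {F : Finset ℝ≥0} (hX : IsFiniteFiltration F X) :
    ∃ g : ∀ t, X.obj t ⟶ X.obj (F.sup id),
      (∀ ⦃s t : ℝ≥0⦄ (h : s ⟶ t), X.map h ≫ g t = g s) ∧
      (∀ t k, Function.Injective (degreeMap (g t) k)) ∧ g (F.sup id) = 𝟙 _ := by
  have hiso (t : ℝ≥0) (ht : F.sup id ≤ t) : IsIso (X.map (homOfLE ht)) :=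
    hX.isIso ht fun a ha hat ↦ hat.1.not_ge (Finset.le_sup (f := id) ha)
  have hiso' (t : ℝ≥0) : IsIso (X.map (homOfLE (le_sup_right : F.sup id ≤ t ⊔ F.sup id))) :=
    hiso _ _
  refine ⟨fun t ↦ X.map (homOfLE le_sup_left) ≫
    inv (X.map (homOfLE (le_sup_right : F.sup id ≤ t ⊔ F.sup id))), ?_, ?_, ?_⟩
  · intro s t h
    have hle : s ⊔ F.sup id ≤ t ⊔ F.sup id := sup_le_sup_right (leOfHom h) _
    have : IsIso (X.map (homOfLE hle)) := hX.isIso hle fun a ha hat ↦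
      hat.1.not_ge ((Finset.le_sup (f := id) ha).trans le_sup_right)
    rw [IsIso.eq_comp_inv]
    have h1 : X.map (homOfLE (le_sup_right : F.sup id ≤ t ⊔ F.sup id)) =
        X.map (homOfLE le_sup_right) ≫ X.map (homOfLE hle) := by
      rw [← X.map_comp]; rfl
    rw [← cancel_mono (X.map (homOfLE hle))]
    simp only [Category.assoc]
    rw [← h1, IsIso.inv_hom_id, Category.comp_id, ← X.map_comp, ← X.map_comp]
    rfl
  · intro t k
    exact (degreeMap_injective (inv (X.map (homOfLE _))) k).comp (hX.injective _ k)
  · rw [IsIso.comp_inv_eq, Category.id_comp]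

/-- Take for `s` the least time at which `x` is present. The images from earlier times form a chain,
so their union is a subspace missing `x`, and a linear form separates the two. -/
theorem exists_separating_functional {F : Finset ℝ≥0} (hX : IsFiniteFiltration F X)
    (g : ∀ t, X.obj t ⟶ C) (hg : ∀ ⦃s t : ℝ≥0⦄ (h : s ⟶ t), X.map h ≫ g t = g s)
    {n : ℕ} {x : C.obj.X n} (hx : x ≠ 0) (hex : ∃ t v, degreeMap (g t) n v = x) :
    ∃ (s : ℝ≥0) (φ : C.obj.X n →ₗ[K] K), (∃ v, degreeMap (g s) n v = x) ∧ φ x = 1 ∧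
      ∀ t < s, ∀ z, φ (degreeMap (g t) n z) = 0 := by
  obtain ⟨s, hs, hmin⟩ := exists_least_of_finset hX.zero_mem (fun s t hst hF ⟨v, hv⟩ ↦ by
    have := hX.isIso hst hF
    obtain ⟨u, rfl⟩ := degreeMap_surjective (X.map (homOfLE hst)) n v
    refine ⟨u, ?_⟩
    rw [← hv, ← degreeMap_comp, hg]) hex
  have hmono : Monotone fun t : {t // t < s} ↦ (degreeMap (g t) n).range := by
    rintro ⟨t, ht⟩ ⟨t', ht'⟩ h _ ⟨v, rfl⟩
    refine ⟨degreeMap (X.map (homOfLE h)) n v, ?_⟩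
    rw [← degreeMap_comp, hg]
  have hnot : x ∉ ⨆ t : {t // t < s}, (degreeMap (g t) n).range := by
    intro h
    -- For `s = 0` there are no earlier times; the supremum is then zero and `x ≠ 0` is what is
    -- needed.
    rcases isEmpty_or_nonempty {t // t < s} with he | he
    · rw [iSup_of_empty, Submodule.mem_bot] at h
      exact hx h
    · rw [Submodule.mem_iSup_of_directed _ hmono.directed_le] at h
      obtain ⟨⟨t, ht⟩, v, hv⟩ := h
      exact ht.not_ge (hmin t ⟨v, hv⟩)
  obtain ⟨φ, hφx, hφ⟩ := Submodule.exists_le_ker_of_notMem hnot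
  refine ⟨s, (φ x)⁻¹ • φ, hs, inv_mul_cancel₀ hφx, fun t ht z ↦ ?_⟩
  have : φ (degreeMap (g t) n z) = 0 :=
    hφ (Submodule.mem_iSup_of_mem (⟨t, ht⟩ : {t // t < s}) ⟨z, rfl⟩)
  rw [LinearMap.smul_apply, this, smul_zero]

/-- The death time is chosen first, as the earliest time with a nonzero differential, and the birth
time afterwards. The bound on `b.s` ensures that the sphere is visible in the terminal value, so
that splitting it off lowers the dimension there. -/
theorem IsFiniteFiltration.exists_retract {F : Finset ℝ≥0} (hX : IsFiniteFiltration F X)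
    {m : ℕ} {x₀ : (X.obj (F.sup id)).obj.X m} (hx₀ : x₀ ≠ 0) :
    ∃ (b : Bar) (i : b.sphere K ⟶ X) (r : X ⟶ b.sphere K), b.s ≤ F.sup id ∧ i ≫ r = 𝟙 _ := by
  obtain ⟨g, hg, hinj, hgT⟩ := hX.exists_embedding
  have hrange (k : ℕ) (x : (X.obj (F.sup id)).obj.X k) : ∃ v, degreeMap (g (F.sup id)) k v = x :=
    ⟨x, by rw [hgT, degreeMap_id]⟩
  have hle {s : ℝ≥0} {k : ℕ} {x : (X.obj (F.sup id)).obj.X k}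
      {φ : (X.obj (F.sup id)).obj.X k →ₗ[K] K} (hφx : φ x = 1)
      (hφ : ∀ t < s, ∀ z, φ (degreeMap (g t) k z) = 0) {t : ℝ≥0}
      (ht : ∃ v, degreeMap (g t) k v = x) : s ≤ t := by
    by_contra h
    obtain ⟨v, rfl⟩ := ht
    rw [hφ t (not_le.1 h)] at hφx
    exact zero_ne_one hφx
  by_cases hd : ∃ t n, ∃ y : (X.obj t).obj.X (n + 1), differential _ (n + 1) n y ≠ 0
  · obtain ⟨e, ⟨n, y, hy⟩, hmin⟩ := exists_least_of_finset hX.zero_mem (fun s t hst hF h ↦ by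
      obtain ⟨n, y, hy⟩ := h
      have := hX.isIso hst hF
      obtain ⟨u, rfl⟩ := degreeMap_surjective (X.map (homOfLE hst)) _ y
      rw [← degreeMap_differential] at hy
      exact ⟨n, u, fun h ↦ hy (by rw [h, map_zero])⟩) hd
    have hdy : differential _ (n + 1) n (degreeMap (g e) (n + 1) y) =
        degreeMap (g e) n (differential _ (n + 1) n y) := (degreeMap_differential _ _ _ _).symm
    obtain ⟨s, φ, hs, hφx, hφ⟩ := exists_separating_functional hX g hg
      (x := degreeMap (g e) n (differential _ (n + 1) n y))
      (fun h ↦ hy (hinj e n (h.trans (map_zero _).symm))) ⟨e, _, rfl⟩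
    refine ⟨⟨n, s, e, ENNReal.coe_le_coe.2 (hle hφx hφ ⟨_, rfl⟩)⟩, ?_⟩
    obtain ⟨i, r, hir⟩ := Bar.exists_retract_of_generators g hg hinj
      ⟨n, s, e, ENNReal.coe_le_coe.2 (hle hφx hφ ⟨_, rfl⟩)⟩ _ (degreeMap (g e) (n + 1) y) φ hs
      (fun t ht ↦ ⟨degreeMap (X.map (homOfLE (ENNReal.coe_le_coe.1 ht))) _ y, by
        rw [← degreeMap_comp, hg]⟩)
      (fun j ↦ by
        rw [← degreeMap_differential, differential_comp_differential, map_zero])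
      (fun _ ↦ hdy) hφ
      -- Minimality of `e` enters here: before `e` every differential is zero, so `φ ∘ d` vanishes.
      (fun t ht z ↦ by
        rw [← degreeMap_differential]
        have : differential _ (n + 1) n z = 0 := by
          by_contra h
          exact (ENNReal.coe_lt_coe.1 ht).not_ge (hmin t ⟨n, z, h⟩)
        rw [this, map_zero, map_zero]) hφx
    exact ⟨i, r, hle hφx hφ (hrange _ _), hir⟩
  · push Not at hd
    obtain ⟨s, φ, hs, hφx, hφ⟩ := exists_separating_functional hX g hg hx₀ ⟨_, hrange _ _⟩
    refine ⟨⟨m, s, ⊤, le_top⟩, ?_⟩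
    have hd' (t i j) (z : (X.obj t).obj.X i) : differential _ i j z = 0 := by
      by_cases hij : i = j + 1
      · subst hij
        exact hd _ _ z
      · exact differential_shape _ hij z
    obtain ⟨i, r, hir⟩ := Bar.exists_retract_of_generators g hg hinj
      ⟨m, s, ⊤, le_top⟩ x₀ 0 φ hs (fun t ht ↦ ⟨0, map_zero _⟩) (fun j ↦ hd' _ _ _ _)
      (fun h ↦ absurd rfl h) hφ (fun t ht z ↦ by rw [hd', map_zero]) hφx
    exact ⟨i, r, hle hφx hφ (hrange _ _), hir⟩

/-- Isomorphisms and monomorphisms are stable under retracts. The same `F` serves, so the induction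
compares values at one fixed time. -/
theorem IsFiniteFiltration.of_retract {F : Finset ℝ≥0} (hX : IsFiniteFiltration F X)
    {Y : ℝ≥0 ⥤ CompactComplex K} (i : Y ⟶ X) (r : X ⟶ Y) (hir : i ≫ r = 𝟙 Y) :
    IsFiniteFiltration F Y where
  zero_mem := hX.zero_mem
  isIso s t h hF := by
    have := hX.isIso h hF
    have happ (t) : i.app t ≫ r.app t = 𝟙 _ := congr_app hir t
    refine ⟨i.app t ≫ inv (X.map (homOfLE h)) ≫ r.app s, ?_, ?_⟩
    · rw [← Category.assoc, i.naturality, Category.assoc, IsIso.hom_inv_id_assoc, happ]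
    · simp only [Category.assoc]
      rw [← r.naturality, IsIso.inv_hom_id_assoc, happ]
  injective s t h k := by
    have hi : Function.Injective (degreeMap (i.app s) k) :=
      Function.LeftInverse.injective (g := degreeMap (r.app s) k) fun x ↦ by
        rw [← degreeMap_comp]
        exact congrArg (fun f : Y.obj s ⟶ Y.obj s ↦ degreeMap f k x) (congr_app hir s)
    refine Function.Injective.of_comp (f := degreeMap (i.app t) k) ?_
    have : degreeMap (i.app t) k ∘ degreeMap (Y.map h) k =
        degreeMap (X.map h) k ∘ degreeMap (i.app s) k :=
      funext fun x ↦ degreeMap_naturality i h k x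
    rw [this]
    exact (hX.injective h k).comp hi

/-- The total dimension of a compact complex. -/
noncomputable def totalDim (X : CompactComplex K) : ℕ := Module.finrank K (⨁ n : ℕ, X.obj.X n)

theorem totalDim_lt {X Y : CompactComplex K} (f : X ⟶ Y)
    (hf : ∀ k, Function.Injective (degreeMap f k)) {n : ℕ} {y : Y.obj.X n}
    (hy : ∀ x, degreeMap f n x ≠ y) : totalDim X < totalDim Y := by
  classical
  have : FiniteDimensional K (⨁ n : ℕ, X.obj.X n) := X.property
  have : FiniteDimensional K (⨁ n : ℕ, Y.obj.X n) := Y.property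
  let Φ : (⨁ n : ℕ, X.obj.X n) →ₗ[K] ⨁ n : ℕ, Y.obj.X n :=
    DFinsupp.mapRange.linearMap (degreeMap f)
  have hΦ : Function.Injective Φ :=
    (DFinsupp.mapRange_injective _ fun k ↦ map_zero (degreeMap f k)).2 hf
  refine (LinearMap.finrank_le_finrank_of_injective hΦ).lt_of_ne fun h ↦ ?_
  obtain ⟨x, hx⟩ := (LinearMap.injective_iff_surjective_of_finrank_eq_finrank h).1 hΦ
    (DirectSum.lof K ℕ (fun n ↦ Y.obj.X n) n y)
  refine hy (x n) ?_
  have h2 := congrArg (DirectSum.component K ℕ (fun n ↦ Y.obj.X n) n) hx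
  rw [DirectSum.component.lof_self] at h2
  exact h2

/-- A finite filtration is a finite direct sum of interval spheres, in terms of inclusions and
projections. -/
theorem IsFiniteFiltration.exists_decomposition {F : Finset ℝ≥0}
    (hX : IsFiniteFiltration F X) :
    ∃ (l : ℕ) (b : Fin l → Bar) (ι : ∀ j, (b j).sphere K ⟶ X) (π : ∀ j, X ⟶ (b j).sphere K),
      (∀ j, ι j ≫ π j = 𝟙 _) ∧ (∀ j j', j ≠ j' → ι j ≫ π j' = 0) ∧ ∑ j, π j ≫ ι j = 𝟙 X := by
  induction hN : totalDim (X.obj (F.sup id)) using Nat.strong_induction_on generalizing X with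
  | _ N ih =>
  by_cases hx : ∃ m, ∃ x₀ : (X.obj (F.sup id)).obj.X m, x₀ ≠ 0
  · obtain ⟨m, x₀, hx₀⟩ := hx
    obtain ⟨b₀, i, r, hb, hir⟩ := hX.exists_retract hx₀
    let k := kernel.ι r
    -- The complement of the split sphere is the kernel of `r`, and the idempotent `1 - r ≫ i`
    -- projects onto it.
    let q : X ⟶ kernel r := kernel.lift r (𝟙 X - r ≫ i) (by
      rw [Preadditive.sub_comp, Category.assoc, hir, Category.id_comp, Category.comp_id, sub_self])
    have hkr : k ≫ r = 0 := kernel.condition r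
    have hqk : q ≫ k = 𝟙 X - r ≫ i := kernel.lift_ι _ _ _
    have hkq : k ≫ q = 𝟙 _ := by
      rw [← cancel_mono k, Category.assoc, hqk, Preadditive.comp_sub, reassoc_of% hkr, zero_comp,
        sub_zero, Category.comp_id, Category.id_comp]
    have hiq : i ≫ q = 0 := by
      rw [← cancel_mono k, Category.assoc, hqk, Preadditive.comp_sub, reassoc_of% hir,
        Category.comp_id, sub_self, zero_comp]
    have hY : IsFiniteFiltration F (kernel r) := hX.of_retract k q hkq
    have hlt : totalDim ((kernel r).obj (F.sup id)) < N := by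
      rw [← hN]
      have hact : b₀.Active (F.sup id) b₀.n := Or.inl ⟨rfl, hb⟩
      refine totalDim_lt (k.app _) (fun j ↦ ?_) (n := b₀.n)
        (y := degreeMap (i.app _) b₀.n (Bar.gen hact)) fun x hx ↦ ?_
      · refine Function.LeftInverse.injective (g := degreeMap (q.app _) j) fun x ↦ ?_
        rw [← degreeMap_comp, ← NatTrans.comp_app, hkq]
        rfl
      -- The generator of the sphere is not in the kernel, as `r` sends it to coordinate 1; hence
      -- the dimension drops strictly.
      · have h2 := congrArg (degreeMap (r.app _) b₀.n) hx
        rw [← degreeMap_comp, ← degreeMap_comp, ← NatTrans.comp_app, ← NatTrans.comp_app, hkr,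
          hir] at h2
        exact zero_ne_one (congrArg (b₀.coord _ _) h2)
    obtain ⟨l, b, ι, π, h1, h0, hsum⟩ := ih _ hlt hY rfl
    refine ⟨l + 1, Fin.cons b₀ b,
      Fin.cases (motive := fun j ↦ ((Fin.cons b₀ b : Fin (l + 1) → Bar) j).sphere K ⟶ X)
        i (fun j ↦ ι j ≫ k),
      Fin.cases (motive := fun j ↦ X ⟶ ((Fin.cons b₀ b : Fin (l + 1) → Bar) j).sphere K)
        r (fun j ↦ q ≫ π j), ?_, ?_, ?_⟩
    · refine Fin.cases hir fun j ↦ ?_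
      change (ι j ≫ k) ≫ q ≫ π j = 𝟙 _
      rw [Category.assoc, reassoc_of% hkq, h1]
    · refine Fin.cases (Fin.cases (fun h ↦ absurd rfl h) fun j' _ ↦ ?_)
        fun j ↦ Fin.cases (fun _ ↦ ?_) fun j' hjj ↦ ?_
      · change i ≫ q ≫ π j' = 0
        rw [reassoc_of% hiq, zero_comp]
      · change (ι j ≫ k) ≫ r = 0
        rw [Category.assoc, hkr, comp_zero]
      · change (ι j ≫ k) ≫ q ≫ π j' = 0
        rw [Category.assoc, reassoc_of% hkq, h0 _ _ fun h ↦ hjj (congrArg _ h)]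
    · rw [Fin.sum_univ_succ]
      change r ≫ i + ∑ j, (q ≫ π j) ≫ ι j ≫ k = 𝟙 X
      have : ∑ j, (q ≫ π j) ≫ ι j ≫ k = q ≫ (∑ j, π j ≫ ι j) ≫ k := by
        simp only [Preadditive.sum_comp, Preadditive.comp_sum, Category.assoc]
      rw [this, hsum, Category.id_comp, hqk, add_sub_cancel]
  · push Not at hx
    refine ⟨0, Fin.elim0, fun j ↦ j.elim0, fun j ↦ j.elim0, fun j ↦ j.elim0, fun j ↦ j.elim0, ?_⟩
    -- A zero terminal value makes every value zero, and the empty sum is the identity.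
    obtain ⟨g, -, hinj, -⟩ := hX.exists_embedding
    refine NatTrans.ext (funext fun t ↦ compactComplex_hom_ext fun k x ↦ hinj t k ?_)
    rw [hx _ (degreeMap (g t) k _), hx _ (degreeMap (g t) k _)]

end Splitting

/-! ### Cofibrant objects are finite filtrations -/

section Cofibrant

variable {K : Type u} [Field K]

theorem isZero_initial_obj (s : ℝ≥0) :
    IsZero ((⊥_ (Tame (CompactComplex K))).obj.obj s) :=
  ((evaluation ℝ≥0 (CompactComplex K)).obj s).map_isZero
    ((IsTame (CompactComplex K)).ι.map_isZero (IsZero.of_iso (isZero_zero _)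
      (initialIsInitial.uniqueUpToIso HasZeroObject.zeroIsInitial)))

theorem degreeMap_injective_of_cofibration {X Y : CompactComplex K} (f : X ⟶ Y)
    [hf : Cofibration f] (k : ℕ) : Function.Injective (degreeMap f k) :=
  (ModuleCat.mono_iff_injective (f.hom.f k)).1 (hf.mem k)

/-- The initial object is zero at every time, so each relative transition is, up to isomorphism, the
transition of `X` between consecutive `τ a`. These are injective, and all other transitions are
controlled by them and by the isomorphisms between jumps. -/
theorem isFiniteFiltration_of_isCofibrant (X : Tame (CompactComplex K)) (hX : IsCofibrant X) :
    ∃ F, IsFiniteFiltration F X.obj := by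
  obtain ⟨n, τ, hτ, hτ0, -, hd, -, hcof⟩ := hX.mem
  have hiso ⦃s t : ℝ≥0⦄ (h : s ≤ t)
      (hF : ∀ a ∈ Finset.univ.image τ, ¬ (s < a ∧ a ≤ t)) : IsIso (X.obj.map (homOfLE h)) :=
    hd h fun ⟨a, ha⟩ ↦ hF (τ a) (Finset.mem_image_of_mem _ (Finset.mem_univ a)) ha
  have hstep (a : Fin n) (k : ℕ) : Function.Injective
      (degreeMap (X.obj.map (homOfLE (hτ.monotone a.castSucc_lt_succ.le))) k) := by
    have := hcof a
    have : IsIso ((⊥_ (Tame (CompactComplex K))).obj.map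
        (homOfLE (hτ.monotone a.castSucc_lt_succ.le))) :=
      ⟨0, (isZero_initial_obj _).eq_of_src _ _, (isZero_initial_obj _).eq_of_src _ _⟩
    have h : X.obj.map (homOfLE (hτ.monotone a.castSucc_lt_succ.le)) =
        pushout.inl _ _ ≫ relativeTransition (initial.to X).hom
          (hτ.monotone a.castSucc_lt_succ.le) := by
      rw [relativeTransition, pushout.inl_desc]
    rw [h]
    -- The left inclusion into the pushout is an isomorphism, being a pushout of a map between zero
    -- objects.
    exact (degreeMap_injective_of_cofibration (relativeTransition (initial.to X).hom _) k).comp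
      (degreeMap_injective (pushout.inl _ _) k)
  have hfactor {r s t : ℝ≥0} (hrs : r ≤ s) (hst : s ≤ t) (k : ℕ) :
      degreeMap (X.obj.map (homOfLE (hrs.trans hst))) k =
        degreeMap (X.obj.map (homOfLE hst)) k ∘ degreeMap (X.obj.map (homOfLE hrs)) k :=
    funext fun x ↦ by
      rw [Function.comp_apply, ← degreeMap_comp, ← X.obj.map_comp]
      rfl
  have hlast (k : ℕ) (a : Fin (n + 1)) : Function.Injective
      (degreeMap (X.obj.map (homOfLE (hτ.monotone (Fin.le_last a)))) k) := by
    induction a using Fin.reverseInduction with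
    | last =>
      have := hiso (hτ.monotone (Fin.le_last (Fin.last n))) fun a _ ha ↦ ha.1.not_ge ha.2
      exact degreeMap_injective _ k
    | cast a ih =>
      rw [hfactor (hτ.monotone a.castSucc_lt_succ.le) (hτ.monotone (Fin.le_last a.succ))]
      exact ih.comp (hstep a k)
  refine ⟨Finset.univ.image τ, Finset.mem_image.2 ⟨0, Finset.mem_univ _, hτ0⟩, hiso, ?_⟩
  have hle (k : ℕ) {s t : ℝ≥0} (h : s ≤ t) (ht : t ≤ τ (Fin.last n)) :
      Function.Injective (degreeMap (X.obj.map (homOfLE h)) k) := by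
    obtain ⟨a, ha⟩ := (Finset.univ.filter fun a ↦ τ a ≤ s).exists_maximal
      ⟨0, by simp [hτ0]⟩
    have has : τ a ≤ s := (Finset.mem_filter.1 ha.prop).2
    have : IsIso (X.obj.map (homOfLE has)) := hd has fun ⟨c, hc⟩ ↦
      hc.1.not_ge (hτ.monotone (ha.le_of_ge (Finset.mem_filter.2 ⟨Finset.mem_univ _, hc.2⟩)
        (hτ.lt_iff_lt.1 hc.1).le))
    -- With `τ a` the last point at or before `s`, the transition from `τ a` to `s` is an
    -- isomorphism and cancels.
    have h1 : Function.Injective (degreeMap (X.obj.map (homOfLE (h.trans ht))) k) := by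
      have h2 := hlast k a
      rw [hfactor has (h.trans ht)] at h2
      exact (Function.Injective.of_comp_iff' _
        ⟨degreeMap_injective _ k, degreeMap_surjective _ k⟩).1 h2
    rw [hfactor h ht] at h1
    exact h1.of_comp
  have hge (k : ℕ) {s t : ℝ≥0} (h : s ≤ t) (hs : τ (Fin.last n) ≤ s) :
      Function.Injective (degreeMap (X.obj.map (homOfLE h)) k) := by
    have := hd h fun ⟨c, hc⟩ ↦ hc.1.not_ge ((hτ.monotone (Fin.le_last c)).trans hs)
    exact degreeMap_injective _ k
  intro s t h k
  rcases le_total t (τ (Fin.last n)) with ht | ht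
  · exact hle k (leOfHom h) ht
  rcases le_total (τ (Fin.last n)) s with hs | hs
  · exact hge k (leOfHom h) hs
  · have h2 := (hge k ht le_rfl).comp (hle k hs le_rfl)
    rw [← hfactor] at h2
    exact h2

theorem exists_iso_biproduct_of_isFiniteFiltration (X : Tame (CompactComplex K)) {F : Finset ℝ≥0}
    (hX : IsFiniteFiltration F X.obj) :
    ∃ (l : ℕ) (b : Fin l → Bar), Nonempty (X ≅ ⨁ fun i ↦ (b i).tameSphere K) := by
  obtain ⟨l, b, ι, π, h1, h0, hsum⟩ := hX.exists_decomposition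
  let B : Bicone fun i ↦ (b i).tameSphere K :=
    { pt := X
      ι := fun j ↦ ObjectProperty.homMk (ι j)
      π := fun j ↦ ObjectProperty.homMk (π j)
      ι_π := fun j j' ↦ by
        split_ifs with h
        · subst h
          exact ObjectProperty.hom_ext _ (h1 j)
        · exact ObjectProperty.hom_ext _ (h0 j j' h) }
  refine ⟨l, b, ⟨biproduct.uniqueUpToIso _ (isBilimitOfTotal B (ObjectProperty.hom_ext _ ?_))⟩⟩
  rw [tame_sum_hom]
  exact hsum

end Cofibrant

theorem mainTheorem1 (K : Type u) [Field K] :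
    (∀ X : Tame (CompactComplex K), IsCofibrant X →
      ∃ (l : ℕ) (n : Fin l → ℕ) (s : Fin l → ℝ≥0) (e : Fin l → ℝ≥0∞)
        (hse : ∀ i, (s i : ℝ≥0∞) ≤ e i),
        Nonempty (X ≅ ⨁ fun i ↦ intervalSphere K (n i) (s i) (e i) (hse i))) ∧
    (∀ (l l' : ℕ)
      (n : Fin l → ℕ) (s : Fin l → ℝ≥0) (e : Fin l → ℝ≥0∞)
      (hse : ∀ i, (s i : ℝ≥0∞) ≤ e i)
      (n' : Fin l' → ℕ) (s' : Fin l' → ℝ≥0) (e' : Fin l' → ℝ≥0∞)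
      (hse' : ∀ j, (s' j : ℝ≥0∞) ≤ e' j),
      Nonempty ((⨁ fun i ↦ intervalSphere K (n i) (s i) (e i) (hse i)) ≅
        ⨁ fun j ↦ intervalSphere K (n' j) (s' j) (e' j) (hse' j)) →
      l = l' ∧ ∃ σ : Fin l ≃ Fin l', ∀ i,
        n i = n' (σ i) ∧ s i = s' (σ i) ∧ e i = e' (σ i)) := by
  refine ⟨fun X hX ↦ ?_, fun l l' n s e hse n' s' e' hse' ⟨φ⟩ ↦ ?_⟩
  · obtain ⟨F, hF⟩ := isFiniteFiltration_of_isCofibrant X hX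
    obtain ⟨l, b, h⟩ := exists_iso_biproduct_of_isFiniteFiltration X hF
    exact ⟨l, fun i ↦ (b i).n, fun i ↦ (b i).s, fun i ↦ (b i).e, fun i ↦ (b i).hse, h⟩
  · obtain ⟨σ, hσ⟩ := Bar.exists_equiv_of_iso (fun i ↦ ⟨n i, s i, e i, hse i⟩)
      (fun j ↦ ⟨n' j, s' j, e' j, hse' j⟩) φ
    exact ⟨Fin.equiv_iff_eq.1 ⟨σ⟩, σ, fun i ↦
      ⟨congrArg Bar.n (hσ i), congrArg Bar.s (hσ i), congrArg Bar.e (hσ i)⟩⟩
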